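/- Let $K$ be a field, let $0\le \ell\le n$ be integers, and let $T\in K^{n\times n}$ be nilpotent. Matrices act on row vectors from the right. Notation. For a partition $\lambda=(\lambda_1\ge\dots\ge\lambda_s)$ of $n$, let $T_\lambda$ be the nilpotent matrix in Jordan canonical form with blocks of sizes $\lambda_1,\dots,\lambda_s$ (ones in positions $(j,j+1)$ inside each block), and let $B_\lambda=\mathrm{diag}(\mathrm B_{\lambda_1},\dots,\mathrm B_{\lambda_s})$, where $\mathrm B_m$ is the $m\times m$ matrix with ones on the antidiagonal and zeros elsewhere. For a matrix $A$, $\wedge_\ell A$ is the $\binom n\ell\times\binom n\ell$ matrix of its $\ell\times\ell$ minors, with rows and columns indexed by the $\ell$-subsets of $[n]$. For a vector $P=(p_I)$ indexed by $\ell$-subsets, its Hodge star $P^*=(p^*_J)$, indexed by $(n-\ell)$-subsets, is $p^*_J=\mathrm{sign}(I,J)\,p_I$ with $I=[n]\setminus J$, where $\mathrm{sign}(I,J)$ is the sign of the permutation of $[n]$ that lists $I$ and then $J$, each in increasing order. The shuffle equations of $T$ for $\ell$ are the linear forms in $P$ given by the coordinates of $P\cdot[\wedge_\ell(\mathrm{Id}_n+zT)]_i$,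 $1\le i\le \ell$, where $[\,\cdot\,]_i$ is the coefficient matrix of $z^i$. $\mathrm{Gr}(\ell,n)$ is the set of $\ell$-dimensional subspaces $L$ of $n$-dimensional row space, embedded in $\mathbb P^{\binom n\ell-1}$ by the Plücker embedding $L\mapsto P$ (maximal minors of a matrix with row space $L$), and $\mathrm{Gr}(\ell,n)^T=\{L\in \mathrm{Gr}(\ell,n): LT\subseteq L\}$. Theorem. There are a partition $\lambda$ of $n$ and $g\in GL_n(K)$ with $T=gT_\lambda g^{-1}$. For every such $\lambda$ and $g$, put $B=gB_\lambda g^{\mathrm t}$ (so $B=B_\lambda$ if $T=T_\lambda$ and $g=\mathrm{Id}_n$). Then $B$ is symmetric and invertible, and $TB=BT^{\mathrm t}$, i.e. $T$ is self-adjoint for the form $(u,v)\mapsto uBv^{\mathrm t}$. Moreover, over $K$ and over every extension field $F$ of $K$, the following hold. 1. The map $\Phi(P)=\bigl(P\cdot\wedge_\ell B\bigr)^*$ is a linear isomorphism $F^{\binom n\ell}\to F^{\binom n{n-\ell}}$, and the induced map of projective spaces carries the Plücker image of $\mathrm{Gr}(\ell,n)^T$ onto the Plücker image of $\mathrm{Gr}(n-\ell,n)^T$.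 2. $L\mapsto L^\perp=\{v: uBv^{\mathrm t}=0\text{ for all }u\in L\}$ is a bijection $\mathrm{Gr}(\ell,n)\to\mathrm{Gr}(n-\ell,n)$ which restricts to a bijection $\mathrm{Gr}(\ell,n)^T\to\mathrm{Gr}(n-\ell,n)^T$, and $\Phi$ maps the Plücker point of $L$ to the Plücker point of $L^\perp$ for every $L\in\mathrm{Gr}(\ell,n)$. 3. Substitution of $\Phi$ (i.e. $f\mapsto f\circ\Phi$) carries the linear span of the shuffle equations of $T$ for $n-\ell$ onto the linear span of the shuffle equations of $T$ for $\ell$. -/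

import Mathlib

open Matrix
open scoped LinearAlgebra.Projectivization

noncomputable section

namespace NilpotentGrassmannian

/-! ### Jordan matrices and the block antidiagonal form -/

/-- The `m × m` nilpotent Jordan block: ones in the positions `(j, j + 1)`. -/
def jordanBlock (K : Type*) [Field K] (m : ℕ) : Matrix (Fin m) (Fin m) K :=
  Matrix.of fun i j => if (i : ℕ) + 1 = (j : ℕ) then 1 else 0

/-- The `m × m` matrix with ones on the antidiagonal and zeros elsewhere
(the indices start at `0`). -/
def antidiagonalBlock (K : Type*) [Field K] (m : ℕ) : Matrix (Fin m) (Fin m) K :=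
  Matrix.of fun i j => if (i : ℕ) + (j : ℕ) + 1 = m then 1 else 0

/-- The parts of a partition `lam` of `n` in weakly decreasing order. -/
def sortedParts {n : ℕ} (lam : n.Partition) : List ℕ :=
  lam.parts.sort (fun a b => b ≤ a)

/-- The `k`-th largest part `lam_k` of the partition. -/
def part {n : ℕ} (lam : n.Partition) (k : Fin (sortedParts lam).length) : ℕ :=
  (sortedParts lam).get k

theorem sum_part {n : ℕ} (lam : n.Partition) : ∑ k, part lam k = n := by
  have h : (sortedParts lam).sum = n := by
    have h1 : ((sortedParts lam : List ℕ) : Multiset ℕ) = lam.parts :=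
      Multiset.sort_eq _ _
    rw [← Multiset.sum_coe, h1, lam.parts_sum]
  have h2 : (List.ofFn (part lam)).sum = (sortedParts lam).sum :=
    congrArg List.sum (List.ofFn_get (sortedParts lam))
  rw [← List.sum_ofFn, h2, h]

/-- Consecutive blocks of sizes `lam_1, lam_2, …`, numbered through by `0, …, n - 1`. -/
def blockIndex {n : ℕ} (lam : n.Partition) : (Σ k, Fin (part lam k)) ≃ Fin n :=
  finSigmaFinEquiv.trans (finCongr (sum_part lam))

/-- The nilpotent matrix in Jordan canonical form whose block sizes are the parts of `lam`. -/
def jordanNilpotent (K : Type*) [Field K] {n : ℕ} (lam : n.Partition) :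
    Matrix (Fin n) (Fin n) K :=
  Matrix.reindex (blockIndex lam) (blockIndex lam)
    (Matrix.blockDiagonal' fun k => jordanBlock K (part lam k))

/-- The block diagonal matrix whose blocks are antidiagonal, of sizes the parts of `lam`. -/
def blockAntidiagonal (K : Type*) [Field K] {n : ℕ} (lam : n.Partition) :
    Matrix (Fin n) (Fin n) K :=
  Matrix.reindex (blockIndex lam) (blockIndex lam)
    (Matrix.blockDiagonal' fun k => antidiagonalBlock K (part lam k))

/-! ### Exterior powers of matrices, shuffle equations and the Hodge star -/

/-- The `ℓ`-element subsets of `{0, …, n - 1}`, which index the Plücker coordinates. -/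
abbrev Idx (n ℓ : ℕ) : Type := Set.powersetCard (Fin n) ℓ

/-- The `ℓ`-subset `I` as the increasing sequence of its elements. -/
def Idx.seq {n ℓ : ℕ} (I : Idx n ℓ) : Fin ℓ ↪o Fin n :=
  Finset.orderEmbOfFin I.1 I.2

/-- The `ℓ`-th exterior power of an `n × n` matrix: the matrix of its `ℓ × ℓ` minors. -/
def wedge {R : Type*} [CommRing R] {n : ℕ} (ℓ : ℕ) (A : Matrix (Fin n) (Fin n) R) :
    Matrix (Idx n ℓ) (Idx n ℓ) R :=
  Matrix.of fun I J => (A.submatrix I.seq J.seq).det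

/-- The coefficient of `z ^ i` in the matrix of polynomials `∧_ℓ (Id + z T)`. -/
def wedgeCoeff {K : Type*} [Field K] {n : ℕ} (ℓ : ℕ) (T : Matrix (Fin n) (Fin n) K) (i : ℕ) :
    Matrix (Idx n ℓ) (Idx n ℓ) K :=
  (wedge ℓ (1 + (Polynomial.X : Polynomial K) • T.map Polynomial.C)).map fun p => p.coeff i

/-- The shuffle equations of `T`, as linear forms on the space of Plücker coordinates:
the coordinates of `P ⬝ [∧_ℓ (Id + z T)]_i` for `i = 1, …, ℓ`. -/
def shuffleEquations {K : Type*} [Field K] {n : ℕ} (ℓ : ℕ) (T : Matrix (Fin n) (Fin n) K) :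
    Set (Module.Dual K (Idx n ℓ → K)) :=
  {f | ∃ i ∈ Finset.Icc 1 ℓ, ∃ J : Idx n ℓ, ∀ P, f P = (P ᵥ* wedgeCoeff ℓ T i) J}

/-- The complementary `ℓ`-subset of an `m`-subset of `{0, …, n - 1}`, where `ℓ + m = n`. -/
def Idx.compl {n ℓ m : ℕ} (h : ℓ + m = n) (J : Idx n m) : Idx n ℓ :=
  ⟨J.1ᶜ, by
    have hJ : J.1.card = m := J.2
    change (J.1ᶜ).card = ℓ
    rw [Finset.card_compl, Fintype.card_fin]
    omega⟩

/-- The permutation of `{0, …, n - 1}` given by the sequence `(I, J)`, where `I` is the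
complement of `J` and both are listed in increasing order. -/
def shufflePerm {n ℓ m : ℕ} (h : ℓ + m = n) (J : Idx n m) : Equiv.Perm (Fin n) :=
  ((finCongr h).symm.trans finSumFinEquiv.symm).trans
    (finSumEquivOfFinset (s := (J.compl h).1) (J.compl h).2 (by
      have hJ : J.1.card = m := J.2
      change ((J.1ᶜ)ᶜ).card = m
      rw [compl_compl, hJ]))

/-- The Hodge star `P ↦ P*`, with `p*_J = sign (I, J) p_I` for `I` the complement of `J`. -/
def hodgeStar {K : Type*} [Field K] {n ℓ m : ℕ} (h : ℓ + m = n) (P : Idx n ℓ → K) :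
    Idx n m → K :=
  fun J => ((Equiv.Perm.sign (shufflePerm h J) : ℤ) : K) * P (J.compl h)

/-! ### Grassmannians and the Plücker embedding -/

/-- The `ℓ`-dimensional subspaces of `K ^ n` (row vectors). -/
def Gr (K : Type*) [Field K] (n ℓ : ℕ) : Set (Submodule K (Fin n → K)) :=
  {L | Module.finrank K L = ℓ}

/-- The `ℓ`-dimensional subspaces `L` of `K ^ n` with `L T ⊆ L`. -/
def fixedGr {K : Type*} [Field K] {n : ℕ} (ℓ : ℕ) (T : Matrix (Fin n) (Fin n) K) :
    Set (Submodule K (Fin n → K)) :=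
  {L | L ∈ Gr K n ℓ ∧ ∀ v ∈ L, v ᵥ* T ∈ L}

/-- The vector of maximal minors of an `ℓ × n` matrix. -/
def maxMinors {K : Type*} [Field K] {n ℓ : ℕ} (A : Matrix (Fin ℓ) (Fin n) K) : Idx n ℓ → K :=
  fun I => (A.submatrix id I.seq).det

theorem maxMinors_ne_zero {K : Type*} [Field K] {n ℓ : ℕ} (A : Matrix (Fin ℓ) (Fin n) K)
    (hA : LinearIndependent K A.row) : maxMinors A ≠ 0 := by
  classical
  have hr : Module.finrank K (Submodule.span K (Set.range A.col)) = ℓ := by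
    rw [← Matrix.rank_eq_finrank_span_cols, hA.rank_matrix, Fintype.card_fin]
  obtain ⟨κ, a, ha, hspan, hli⟩ := exists_linearIndependent' K A.col
  have : Finite κ := Finite.of_injective a ha
  have : Fintype κ := Fintype.ofFinite κ
  have hcard : Fintype.card κ = ℓ := by
    rw [← finrank_span_eq_card hli, hspan, hr]
  let I : Idx n ℓ := ⟨Finset.univ.image a, by
    change (Finset.univ.image a).card = ℓ
    rw [Finset.card_image_of_injective _ ha, Finset.card_univ, hcard]⟩
  intro h0
  have hdet : (A.submatrix id I.seq).det = 0 := congrFun h0 I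
  have hmem : ∀ i : Fin ℓ, ∃ k : κ, a k = I.seq i := by
    intro i
    have : I.seq i ∈ Finset.univ.image a := Finset.orderEmbOfFin_mem I.1 I.2 i
    simpa using this
  choose g hg using hmem
  have hginj : Function.Injective g := by
    intro i j hij
    apply I.seq.injective
    rw [← hg i, ← hg j, hij]
  have hli2 : LinearIndependent K (A.submatrix id I.seq).col := by
    have h2 := hli.comp g hginj
    have h3 : (A.submatrix id I.seq).col = (A.col ∘ a) ∘ g := by
      funext i j
      change A j (I.seq i) = A j (a (g i))
      rw [hg]
    rw [h3]
    exact h2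
  have hu := Matrix.linearIndependent_cols_iff_isUnit.mp hli2
  rw [Matrix.isUnit_iff_isUnit_det, hdet] at hu
  exact not_isUnit_zero hu

/-- A matrix whose rows are a basis of the `ℓ`-dimensional subspace `L`. -/
def basisMatrix {K : Type*} [Field K] {n ℓ : ℕ} (L : Gr K n ℓ) : Matrix (Fin ℓ) (Fin n) K :=
  Matrix.of fun i => (Module.finBasisOfFinrankEq K L.1 L.2 i : Fin n → K)

theorem basisMatrix_linearIndependent {K : Type*} [Field K] {n ℓ : ℕ} (L : Gr K n ℓ) :
    LinearIndependent K (basisMatrix L).row :=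
  (Module.finBasisOfFinrankEq K L.1 L.2).linearIndependent.map' L.1.subtype
    (Submodule.ker_subtype _)

/-- The Plücker embedding: the class in projective space of the maximal minors of a matrix with
row space `L`; see `plucker_eq` for the independence of the choice of this matrix. -/
def plucker {K : Type*} [Field K] {n ℓ : ℕ} (L : Gr K n ℓ) : ℙ K (Idx n ℓ → K) :=
  Projectivization.mk K (maxMinors (basisMatrix L))
    (maxMinors_ne_zero _ (basisMatrix_linearIndependent L))

theorem plucker_eq {K : Type*} [Field K] {n ℓ : ℕ} (L : Gr K n ℓ)
    (A : Matrix (Fin ℓ) (Fin n) K) (hA : LinearIndependent K A.row)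
    (hL : Submodule.span K (Set.range A.row) = L.1) :
    plucker L = Projectivization.mk K (maxMinors A) (maxMinors_ne_zero A hA) := by
  have hmem : ∀ i, A.row i ∈ L.1 := fun i => hL ▸ Submodule.subset_span ⟨i, rfl⟩
  let b := Module.finBasisOfFinrankEq K L.1 L.2
  let C : Matrix (Fin ℓ) (Fin ℓ) K := Matrix.of fun i j => b.repr ⟨A.row i, hmem i⟩ j
  have hAC : A = C * basisMatrix L := by
    ext i j
    have h := congrArg (fun v : L.1 => (v : Fin n → K) j) (b.sum_repr ⟨A.row i, hmem i⟩)
    simp only [Submodule.coe_sum, Finset.sum_apply, Submodule.coe_smul, Pi.smul_apply,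
      smul_eq_mul] at h
    rw [Matrix.mul_apply]
    exact h.symm
  have hm : maxMinors A = C.det • maxMinors (basisMatrix L) := by
    funext I
    have h1 : A.submatrix id I.seq = C * (basisMatrix L).submatrix id I.seq := by
      rw [hAC]
      rfl
    simp only [maxMinors, Pi.smul_apply, smul_eq_mul]
    rw [h1, Matrix.det_mul]
  have hC : C.det ≠ 0 := by
    intro h0
    apply maxMinors_ne_zero A hA
    rw [hm, h0, zero_smul]
  symm
  unfold plucker
  rw [Projectivization.mk_eq_mk_iff']
  exact ⟨C.det, hm.symm⟩

/-- The fixed point locus of `T` as a subset of the projective space of Plücker coordinates. -/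
def fixedVariety {K : Type*} [Field K] {n : ℕ} (ℓ : ℕ) (T : Matrix (Fin n) (Fin n) K) :
    Set (ℙ K (Idx n ℓ → K)) :=
  plucker '' {L : Gr K n ℓ | L.1 ∈ fixedGr ℓ T}

/-- The orthogonal space `{v | u B vᵗ = 0 for all u ∈ L}`. -/
def orth {K : Type*} [Field K] {n : ℕ} (B : Matrix (Fin n) (Fin n) K)
    (L : Submodule K (Fin n → K)) : Submodule K (Fin n → K) :=
  (Matrix.toBilin' B).orthogonal L

end NilpotentGrassmannian

end

open NilpotentGrassmannian

/-! Apart from nilpotency of $T$, the duality needs only that $B$ is symmetric and invertible and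
that $TB=BT^t$. For a Jordan block this is the symmetry of a Hankel matrix; block sums and
congruence by $g$ carry it to $B$. These properties survive extension of scalars, so the duality can
be proved directly over $F$.

On subspaces: if the rows of $A$ span $L$ and those of $D$ span $L^\perp$, then $(AB)D^t=0$.
Complementary maximal minors of two such matrices agree up to sign and a common factor
(`star_minors_mul_det`), and by Cauchy–Binet (`minors_mul`) the minors of $AB$ are
$P\cdot\wedge_\ell B$. Hence $\Phi$ sends the Plücker point of $L$ to that of $L^\perp$.
Self-adjointness makes $L^\perp$ stable under $T$ when $L$ is, and $L^{\perp\perp}=L$ gives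
bijectivity.

On equations: $P$ satisfies the shuffle equations iff $P\cdot\wedge_\ell A=P$ over $F[z]$, where
$A=\mathrm{Id}+zT$. Laplace expansion gives $(Q\cdot\wedge_\ell A^t)^*\cdot\wedge_m A=\det(A)\,Q^*$,
with $m=n-\ell$ (`star_vecMul_wedge`). Here $\det A=1$ by nilpotency and $AB=BA^t$, so $\Phi$
matches the two solution spaces; in finite dimension these determine the spans.

The Jordan form comes from the structure theorem for torsion modules over $K[X]$. -/

namespace NilpotentGrassmannian

/-! ### Minors over a commutative ring: Cauchy–Binet, Hodge star, Laplace expansion -/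

section Minors

variable {R : Type*} [CommRing R] {n ℓ m : ℕ}

/-- The vector of maximal minors of an `ℓ × n` matrix over a commutative ring. -/
def minors (A : Matrix (Fin ℓ) (Fin n) R) : Idx n ℓ → R :=
  fun I => (A.submatrix id I.seq).det

theorem minors_submatrix_seq (A : Matrix (Fin n) (Fin n) R) (I : Idx n ℓ) :
    minors (A.submatrix I.seq id) = wedge ℓ A I := rfl

theorem Idx.range_seq (I : Idx n ℓ) : Set.range I.seq = (I.1 : Set (Fin n)) :=
  Finset.range_orderEmbOfFin I.1 I.2

theorem Idx.seq_mem (I : Idx n ℓ) (i : Fin ℓ) : I.seq i ∈ I.1 :=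
  Finset.orderEmbOfFin_mem I.1 I.2 i

/-- The range recovers the subset, and then the order of the terms recovers the permutation. With
`Idx.exists_seq_comp_perm`, this sorts sums over injective sequences by their ranges. -/
theorem Idx.seq_comp_perm_injective :
    Function.Injective (fun x : Idx n ℓ × Equiv.Perm (Fin ℓ) => (x.1.seq ∘ x.2 : Fin ℓ → Fin n)) := by
  rintro ⟨I, α⟩ ⟨J, β⟩ h
  simp only at h
  have hr := congrArg Set.range h
  rw [EquivLike.range_comp, EquivLike.range_comp, I.range_seq, J.range_seq] at hr
  obtain rfl : I = J := Subtype.ext (by exact_mod_cast hr)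
  simp only [Prod.mk.injEq, true_and]
  ext i
  exact congrArg _ (I.seq.injective (congrFun h i))

theorem Idx.exists_seq_comp_perm {f : Fin ℓ → Fin n} (hf : Function.Injective f) :
    ∃ (I : Idx n ℓ) (α : Equiv.Perm (Fin ℓ)), I.seq ∘ α = f := by
  let I : Idx n ℓ := ⟨Finset.univ.image f, by
    change (Finset.univ.image f).card = ℓ
    rw [Finset.card_image_of_injective _ hf, Finset.card_univ, Fintype.card_fin]⟩
  have h : ∀ i, ∃ j, I.seq j = f i := fun i => by
    have : f i ∈ Set.range I.seq := by rw [I.range_seq]; simp [I]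
    exact this
  choose g hg using h
  have hgi : Function.Injective g := fun i j hij => hf (by rw [← hg, ← hg, hij])
  exact ⟨I, Equiv.ofBijective g (Finite.injective_iff_bijective.1 hgi), funext hg⟩

/-- The **Cauchy–Binet formula**. -/
theorem minors_mul (C : Matrix (Fin ℓ) (Fin n) R) (A : Matrix (Fin n) (Fin n) R) :
    minors (C * A) = minors C ᵥ* wedge ℓ A := by
  funext K
  have hL : minors (C * A) K
      = ∑ f : Fin ℓ → Fin n, (∏ i, C i (f i)) * (A.submatrix f K.seq).det := by
    have h1 : (C * A).submatrix id K.seq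
        = fun i => ∑ j, C i j • fun k => A j (K.seq k) := by
      ext i k
      simp [Matrix.mul_apply, Finset.sum_apply]
    -- Each row of the product is a combination of rows of `A`; multilinearity expands the
    -- determinant over all choices `f` of one row of `A` per factor.
    change Matrix.detRowAlternating.toMultilinearMap ((C * A).submatrix id K.seq) = _
    rw [h1, MultilinearMap.map_sum]
    refine Finset.sum_congr rfl fun f _ => ?_
    rw [MultilinearMap.map_smul_univ]
    rfl
  rw [hL]
  symm
  have hR : (minors C ᵥ* wedge ℓ A) K = ∑ x : Idx n ℓ × Equiv.Perm (Fin ℓ),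
      (∏ i, C i (x.1.seq (x.2 i))) * (A.submatrix (x.1.seq ∘ x.2) K.seq).det := by
    rw [Fintype.sum_prod_type]
    refine Finset.sum_congr rfl fun J _ => ?_
    change (C.submatrix id J.seq).det * (A.submatrix J.seq K.seq).det = _
    rw [← Matrix.det_transpose, Matrix.det_apply', Finset.sum_mul]
    refine Finset.sum_congr rfl fun α _ => ?_
    have h2 : A.submatrix (J.seq ∘ α) K.seq = (A.submatrix J.seq K.seq).submatrix α id := rfl
    rw [h2, Matrix.det_permute]
    simp only [transpose_apply, submatrix_apply, id]
    ring
  rw [hR]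
  refine Finset.sum_of_injOn (fun x : Idx n ℓ × Equiv.Perm (Fin ℓ) => (x.1.seq ∘ x.2))
    Idx.seq_comp_perm_injective.injOn (fun _ _ => Finset.mem_coe.2 (Finset.mem_univ _)) ?_ ?_
  -- A choice `f` that is not a sorted subset followed by a permutation repeats a row, so its
  -- determinant vanishes.
  · intro f _ hf
    have hni : ¬ Function.Injective f := by
      intro hi
      obtain ⟨I, α, h⟩ := Idx.exists_seq_comp_perm hi
      exact hf ⟨(I, α), by simp, h⟩
    obtain ⟨i, j, hij, hne⟩ : ∃ i j, f i = f j ∧ i ≠ j := by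
      simpa [Function.Injective] using hni
    rw [Matrix.det_zero_of_row_eq hne, mul_zero]
    funext k
    simp [hij]
  · intro x _
    rfl

theorem wedge_mul (A B : Matrix (Fin n) (Fin n) R) :
    wedge ℓ (A * B) = wedge ℓ A * wedge ℓ B := by
  funext I
  rw [← minors_submatrix_seq]
  have : (A * B).submatrix I.seq id = A.submatrix I.seq id * B := rfl
  rw [this, minors_mul]
  rfl

theorem wedge_one : wedge ℓ (1 : Matrix (Fin n) (Fin n) R) = 1 := by
  ext I J
  change ((1 : Matrix (Fin n) (Fin n) R).submatrix I.seq J.seq).det = _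
  by_cases h : I = J
  · subst h
    rw [Matrix.submatrix_one _ I.seq.injective, Matrix.det_one, Matrix.one_apply_eq]
  · rw [Matrix.one_apply_ne h]
    -- An element of `I` outside `J` indexes a zero row of the submatrix.
    obtain ⟨i, hi, hiJ⟩ := (Set.powersetCard.exists_mem_notMem_iff_ne I J).1 h
    obtain ⟨k, rfl⟩ : i ∈ Set.range I.seq := by rw [I.range_seq]; exact hi
    refine Matrix.det_eq_zero_of_row_eq_zero k fun j => ?_
    rw [submatrix_apply, Matrix.one_apply_ne]
    intro hkj
    exact hiJ (hkj ▸ J.seq_mem j)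

theorem wedge_map {S : Type*} [CommRing S] (f : R →+* S) (A : Matrix (Fin n) (Fin n) R) :
    wedge ℓ (A.map f) = (wedge ℓ A).map f := by
  ext I J
  exact (RingHom.map_det f (A.submatrix I.seq J.seq)).symm

/-- The Hodge star over a commutative ring, as a linear map. -/
def star (R : Type*) [CommRing R] (h : ℓ + m = n) : (Idx n ℓ → R) →ₗ[R] (Idx n m → R) where
  toFun P J := ((Equiv.Perm.sign (shufflePerm h J) : ℤ) : R) * P (J.compl h)
  map_add' P Q := by funext J; simp [mul_add]
  map_smul' c P := by funext J; simp [mul_left_comm]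

theorem star_apply (h : ℓ + m = n) (P : Idx n ℓ → R) (J : Idx n m) :
    star R h P J = ((Equiv.Perm.sign (shufflePerm h J) : ℤ) : R) * P (J.compl h) := rfl

theorem star_injective (h : ℓ + m = n) : Function.Injective (star R h) := by
  intro P Q hPQ
  funext I
  let J : Idx n m := I.compl ((add_comm m ℓ).trans h)
  have hJ : J.compl h = I := Subtype.ext (compl_compl I.1)
  have h1 := congrFun hPQ J
  rw [star_apply, star_apply, hJ] at h1
  rcases Int.units_eq_one_or (Equiv.Perm.sign (shufflePerm h J)) with hs | hs <;>
    simpa [hs] using h1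

/-- The decomposition of `{0, …, n - 1}` into the first `ℓ` and the last `m` indices. -/
def splitIndex (h : ℓ + m = n) : Fin n ≃ Fin ℓ ⊕ Fin m :=
  (finCongr h).symm.trans finSumFinEquiv.symm

/-- The square matrix with the rows of `C` followed by the rows of `D`. -/
def stack (h : ℓ + m = n) (C : Matrix (Fin ℓ) (Fin n) R) (D : Matrix (Fin m) (Fin n) R) :
    Matrix (Fin n) (Fin n) R :=
  (Matrix.fromRows C D).submatrix (splitIndex h) id

theorem stack_mul (h : ℓ + m = n) (C : Matrix (Fin ℓ) (Fin n) R) (D : Matrix (Fin m) (Fin n) R)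
    (A : Matrix (Fin n) (Fin n) R) : stack h C D * A = stack h (C * A) (D * A) := by
  unfold stack
  rw [← Matrix.fromRows_mul]
  rfl

theorem shufflePerm_inl (h : ℓ + m = n) (J : Idx n m) (i : Fin ℓ) :
    shufflePerm h J ((splitIndex h).symm (Sum.inl i)) = (J.compl h).seq i := by
  simp only [shufflePerm, splitIndex, Idx.seq, Equiv.trans_apply, Equiv.symm_trans_apply,
    Equiv.symm_symm, Equiv.symm_apply_apply]
  rfl

theorem shufflePerm_inr (h : ℓ + m = n) (J : Idx n m) (i : Fin m) :
    shufflePerm h J ((splitIndex h).symm (Sum.inr i)) = J.seq i := by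
  simp [shufflePerm, splitIndex, Idx.seq, Idx.compl]

/-- The permutation of `{0, …, n - 1}` that permutes the first `ℓ` indices by `α` and the last
`m` indices by `β`. -/
def splitPerm (h : ℓ + m = n) (α : Equiv.Perm (Fin ℓ)) (β : Equiv.Perm (Fin m)) :
    Equiv.Perm (Fin n) :=
  (splitIndex h).symm.permCongr (Equiv.sumCongr α β)

theorem splitPerm_apply (h : ℓ + m = n) (α : Equiv.Perm (Fin ℓ)) (β : Equiv.Perm (Fin m))
    (x : Fin ℓ ⊕ Fin m) : splitPerm h α β ((splitIndex h).symm x)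
      = (splitIndex h).symm (Equiv.sumCongr α β x) := by
  simp [splitPerm, Equiv.permCongr_apply]

/-- Shuffles represent the cosets of $S_\ell\times S_m$ in $S_n$. Injectivity is read off from the
images of the last $m$ and the first $\ell$ indices; surjectivity follows from $n!=\binom
nm\,\ell!\,m!$. -/
theorem shufflePerm_mul_splitPerm_bijective (h : ℓ + m = n) :
    Function.Bijective (fun x : Idx n m × Equiv.Perm (Fin ℓ) × Equiv.Perm (Fin m) =>
      shufflePerm h x.1 * splitPerm h x.2.1 x.2.2) := by
  rw [Fintype.bijective_iff_injective_and_card]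
  constructor
  · rintro ⟨J, α, β⟩ ⟨J', α', β'⟩ hx
    simp only at hx
    have h1 : (⟨J, β⟩ : Idx n m × Equiv.Perm (Fin m)) = ⟨J', β'⟩ := by
      apply Idx.seq_comp_perm_injective
      funext i
      have := congrArg (fun σ : Equiv.Perm (Fin n) => σ ((splitIndex h).symm (Sum.inr i))) hx
      simpa [Equiv.Perm.mul_apply, splitPerm_apply, shufflePerm_inr] using this
    obtain ⟨rfl, rfl⟩ := Prod.mk.inj h1
    have h2 : α = α' := by
      ext i
      have := congrArg (fun σ : Equiv.Perm (Fin n) => σ ((splitIndex h).symm (Sum.inl i))) hx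
      simp only [Equiv.Perm.mul_apply, splitPerm_apply, Equiv.sumCongr_apply, Sum.map_inl,
        shufflePerm_inl] at this
      exact congrArg _ ((J.compl h).seq.injective this)
    rw [h2]
  · have hc : Fintype.card (Idx n m) = n.choose m := by
      rw [← Nat.card_eq_fintype_card, Set.powersetCard.card, Nat.card_eq_fintype_card,
        Fintype.card_fin]
    rw [Fintype.card_prod, Fintype.card_prod, Fintype.card_perm, Fintype.card_perm,
      Fintype.card_perm, hc, Fintype.card_fin, Fintype.card_fin, Fintype.card_fin]
    subst h
    rw [← Nat.choose_mul_factorial_mul_factorial (Nat.le_add_left m ℓ), Nat.add_sub_cancel]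
    ring

/-- The **Laplace expansion** along the first `ℓ` rows. -/
theorem star_minors_dotProduct (h : ℓ + m = n) (C : Matrix (Fin ℓ) (Fin n) R)
    (D : Matrix (Fin m) (Fin n) R) :
    star R h (minors C) ⬝ᵥ minors D = (stack h C D).det := by
  rw [← Matrix.det_transpose (stack h C D), Matrix.det_apply',
    ← (shufflePerm_mul_splitPerm_bijective h).sum_comp, Fintype.sum_prod_type]
  refine Finset.sum_congr rfl fun J _ => ?_
  rw [star_apply]
  unfold minors
  rw [← Matrix.det_transpose (C.submatrix _ _), ← Matrix.det_transpose (D.submatrix _ _),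
    Matrix.det_apply', Matrix.det_apply', mul_assoc, Finset.sum_mul_sum, Finset.mul_sum,
    Fintype.sum_prod_type]
  refine Finset.sum_congr rfl fun α _ => ?_
  rw [Finset.mul_sum]
  refine Finset.sum_congr rfl fun β _ => ?_
  have hsign : Equiv.Perm.sign (splitPerm h α β) = Equiv.Perm.sign α * Equiv.Perm.sign β := by
    rw [splitPerm, Equiv.Perm.sign_permCongr, Equiv.Perm.sign_sumCongr]
  have hprod : ∏ i, (stack h C D)ᵀ ((shufflePerm h J * splitPerm h α β) i) i
      = (∏ i, C i ((J.compl h).seq (α i))) * ∏ i, D i (J.seq (β i)) := by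
    rw [← (splitIndex h).symm.prod_comp, Fintype.prod_sum_type]
    simp [Equiv.Perm.mul_apply, splitPerm_apply, shufflePerm_inl, shufflePerm_inr, stack]
  rw [hprod, map_mul, hsign]
  simp only [transpose_apply, submatrix_apply, id]
  push_cast
  ring

/-- By Laplace, pairing the starred minors of rows $I$ of $A$ with the minors of rows $H$ gives the
determinant of these rows stacked. That stack is the corresponding stack of unit rows times $A$, so
$\det A$ factors out. -/
theorem star_vecMul_wedge (h : ℓ + m = n) (A : Matrix (Fin n) (Fin n) R) (P : Idx n ℓ → R) :
    star R h (P ᵥ* wedge ℓ A) ᵥ* wedge m Aᵀ = A.det • star R h P := by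
  suffices hs : (wedge m Aᵀ).vecMulLinear ∘ₗ star R h ∘ₗ (wedge ℓ A).vecMulLinear
      = A.det • star R h from LinearMap.congr_fun hs P
  -- By linearity it suffices to take the basis vector at `I`.
  refine LinearMap.pi_ext' fun I => LinearMap.ext_ring ?_
  funext H
  have key : ∀ E : Matrix (Fin n) (Fin n) R,
      (star R h (wedge ℓ E I) ᵥ* wedge m Eᵀ) H
        = (stack h (E.submatrix I.seq id) (E.submatrix H.seq id)).det := by
    intro E
    rw [← star_minors_dotProduct, minors_submatrix_seq, minors_submatrix_seq]
    refine Finset.sum_congr rfl fun J _ => ?_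
    congr 1
    exact Matrix.det_transpose (E.submatrix H.seq J.seq)
  have hA := key A
  have h1 := key 1
  have hst : stack h (A.submatrix I.seq id) (A.submatrix H.seq id)
      = stack h ((1 : Matrix (Fin n) (Fin n) R).submatrix I.seq id)
          ((1 : Matrix (Fin n) (Fin n) R).submatrix H.seq id) * A := by
    rw [stack_mul]
    congr 1 <;> ext i j <;> simp [Matrix.mul_apply, Matrix.one_apply]
  rw [hst, Matrix.det_mul, ← h1, Matrix.transpose_one, wedge_one, wedge_one, Matrix.vecMul_one]
    at hA
  simp only [LinearMap.comp_apply, LinearMap.single_apply, LinearMap.smul_apply, Pi.smul_apply,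
    smul_eq_mul, Matrix.coe_vecMulLinear, Matrix.single_one_vecMul]
  rw [mul_comm]
  convert! hA using 3
  · funext K
    simp [Matrix.one_apply, Pi.single_apply, eq_comm]

end Minors

/-! ### Orthogonal complements in Plücker coordinates -/

section Duality

variable {F : Type*} [Field F] {n ℓ m : ℕ}

/-- The maximal minors of `C` are up to sign and a common factor the complementary minors of a
matrix `D` whose rows annihilate those of `C`. -/
theorem star_minors_mul_det (h : ℓ + m = n) {C : Matrix (Fin ℓ) (Fin n) F}
    {D : Matrix (Fin m) (Fin n) F} {Y : Matrix (Fin n) (Fin ℓ) F} (hCD : C * Dᵀ = 0)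
    (hCY : C * Y = 1) (J : Idx n m) :
    star F h (minors C) J * (stack h Yᵀ D).det = minors D J := by
  -- The only nonzero maximal minor of these unit rows is the one at `J`, so Laplace picks out one
  -- coordinate of the star. The product below is block triangular with diagonal blocks `C * Y = 1`
  -- and `U * Dᵀ`.
  let U : Matrix (Fin m) (Fin n) F := (1 : Matrix (Fin n) (Fin n) F).submatrix J.seq id
  have hU : star F h (minors C) J = (stack h C U).det := by
    rw [← star_minors_dotProduct, minors_submatrix_seq, wedge_one]
    simp [dotProduct, Matrix.one_apply]
  have hmul : stack h C U * (stack h Yᵀ D)ᵀ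
      = (Matrix.fromBlocks 1 0 (U * Y) (U * Dᵀ)).submatrix (splitIndex h) (splitIndex h) := by
    unfold stack
    rw [Matrix.transpose_submatrix, ← Matrix.submatrix_mul _ _ _ id _ Function.bijective_id,
      Matrix.transpose_fromRows, Matrix.transpose_transpose, Matrix.fromRows_mul_fromCols,
      hCY, hCD]
  rw [hU, ← Matrix.det_transpose (stack h Yᵀ D), ← Matrix.det_mul, hmul,
    Matrix.det_submatrix_equiv_self, Matrix.det_fromBlocks_zero₁₂, Matrix.det_one, one_mul]
  have hUD : U * Dᵀ = (D.submatrix id J.seq)ᵀ := by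
    ext i j
    simp [U, Matrix.mul_apply, Matrix.one_apply]
  rw [hUD, Matrix.det_transpose]
  rfl

/-- The linear isomorphism `P ↦ (P ⬝ ∧_ℓ B)*`. -/
noncomputable def dualityEquiv (h : ℓ + m = n) (B : Matrix (Fin n) (Fin n) F) (hB : IsUnit B) :
    (Idx n ℓ → F) ≃ₗ[F] (Idx n m → F) :=
  LinearEquiv.ofInjectiveOfFinrankEq (star F h ∘ₗ (wedge ℓ B).vecMulLinear)
    (by
      refine (star_injective h).comp ?_
      refine Function.LeftInverse.injective (g := fun P => P ᵥ* wedge ℓ B⁻¹) fun P => ?_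
      change P ᵥ* wedge ℓ B ᵥ* wedge ℓ B⁻¹ = P
      rw [Matrix.vecMul_vecMul, ← wedge_mul,
        Matrix.mul_nonsing_inv _ ((Matrix.isUnit_iff_isUnit_det B).1 hB), wedge_one,
        Matrix.vecMul_one])
    (by
      rw [Module.finrank_fintype_fun_eq_card, Module.finrank_fintype_fun_eq_card,
        ← Nat.card_eq_fintype_card, ← Nat.card_eq_fintype_card, Set.powersetCard.card,
        Set.powersetCard.card, Nat.card_eq_fintype_card, Fintype.card_fin,
        Nat.choose_symm_of_eq_add h.symm])

theorem dualityEquiv_apply (h : ℓ + m = n) (B : Matrix (Fin n) (Fin n) F) (hB : IsUnit B)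
    (P : Idx n ℓ → F) : dualityEquiv h B hB P = star F h (P ᵥ* wedge ℓ B) := rfl

theorem mem_orth {B : Matrix (Fin n) (Fin n) F} {L : Submodule F (Fin n → F)} {v : Fin n → F} :
    v ∈ orth B L ↔ ∀ u ∈ L, (u ᵥ* B) ⬝ᵥ v = 0 := by
  simp only [orth, LinearMap.BilinForm.mem_orthogonal_iff,
    Matrix.toBilin'_apply', Matrix.dotProduct_mulVec]

theorem toBilin'_nondegenerate {B : Matrix (Fin n) (Fin n) F} (hB : IsUnit B) :
    (Matrix.toBilin' B).Nondegenerate := by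
  rw [LinearMap.BilinForm.nondegenerate_toBilin'_iff_det_ne_zero]
  exact ((Matrix.isUnit_iff_isUnit_det B).1 hB).ne_zero

theorem orth_mem_Gr (h : ℓ + m = n) {B : Matrix (Fin n) (Fin n) F} (hB : IsUnit B)
    {L : Submodule F (Fin n → F)} (hL : L ∈ Gr F n ℓ) : orth B L ∈ Gr F n m := by
  change Module.finrank F (orth B L) = m
  rw [orth, LinearMap.BilinForm.finrank_orthogonal (toBilin'_nondegenerate hB),
    Module.finrank_fin_fun, show Module.finrank F L = ℓ from hL]
  omega

theorem orth_orth {B : Matrix (Fin n) (Fin n) F} (hB : IsUnit B) (hs : B.IsSymm)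
    (L : Submodule F (Fin n → F)) : orth B (orth B L) = L := by
  refine LinearMap.BilinForm.orthogonal_orthogonal (toBilin'_nondegenerate hB) ?_ L
  intro u v huv
  rw [Matrix.toBilin'_apply'] at huv ⊢
  rwa [Matrix.dotProduct_mulVec, ← Matrix.mulVec_transpose, hs, dotProduct_comm]

/-- Self-adjointness moves $T$ across the form: $uB(vT)^t=(uT)Bv^t$, and $uT$ stays in $L$. -/
theorem orth_mem_fixedGr (h : ℓ + m = n) {T B : Matrix (Fin n) (Fin n) F} (hB : IsUnit B)
    (hTB : T * B = B * Tᵀ) {L : Submodule F (Fin n → F)} (hL : L ∈ fixedGr ℓ T) :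
    orth B L ∈ fixedGr m T := by
  refine ⟨orth_mem_Gr h hB hL.1, fun v hv => ?_⟩
  rw [mem_orth] at hv ⊢
  intro u hu
  rw [← Matrix.mulVec_transpose T, Matrix.dotProduct_mulVec, Matrix.vecMul_vecMul, ← hTB,
    ← Matrix.vecMul_vecMul]
  exact hv _ (hL.2 u hu)

theorem bijOn_orth_Gr (h : ℓ + m = n) {B : Matrix (Fin n) (Fin n) F} (hB : IsUnit B)
    (hs : B.IsSymm) : Set.BijOn (orth B) (Gr F n ℓ) (Gr F n m) :=
  Set.InvOn.bijOn (f' := orth B)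
    ⟨fun L _ => orth_orth hB hs L, fun L _ => orth_orth hB hs L⟩
    (fun _ hL => orth_mem_Gr h hB hL)
    (fun _ hL => orth_mem_Gr ((add_comm m ℓ).trans h) hB hL)

theorem bijOn_orth_fixedGr (h : ℓ + m = n) {T B : Matrix (Fin n) (Fin n) F} (hB : IsUnit B)
    (hs : B.IsSymm) (hTB : T * B = B * Tᵀ) : Set.BijOn (orth B) (fixedGr ℓ T) (fixedGr m T) :=
  Set.InvOn.bijOn (f' := orth B)
    ⟨fun L _ => orth_orth hB hs L, fun L _ => orth_orth hB hs L⟩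
    (fun _ hL => orth_mem_fixedGr h hB hTB hL)
    (fun _ hL => orth_mem_fixedGr ((add_comm m ℓ).trans h) hB hTB hL)

theorem exists_mul_eq_one_of_linearIndependent_row {A : Matrix (Fin ℓ) (Fin n) F}
    (hA : LinearIndependent F A.row) : ∃ Y : Matrix (Fin n) (Fin ℓ) F, A * Y = 1 := by
  refine Matrix.mulVec_surjective_iff_exists_right_inverse.1 ?_
  refine LinearMap.range_eq_top (f := A.mulVecLin).1 (Submodule.eq_top_of_finrank_eq ?_)
  rw [Module.finrank_fin_fun]
  exact hA.rank_matrix.trans (Fintype.card_fin ℓ)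

theorem map_dualityEquiv_plucker (h : ℓ + m = n) {B : Matrix (Fin n) (Fin n) F} (hB : IsUnit B)
    (L : Gr F n ℓ) :
    Projectivization.map (dualityEquiv h B hB).toLinearMap (dualityEquiv h B hB).injective
      (plucker L) = plucker ⟨orth B L.1, orth_mem_Gr h hB L.2⟩ := by
  set L' : Gr F n m := ⟨orth B L.1, orth_mem_Gr h hB L.2⟩
  set A := basisMatrix L
  set D := basisMatrix L'
  have hdB := (Matrix.isUnit_iff_isUnit_det B).1 hB
  obtain ⟨Y, hY⟩ := exists_mul_eq_one_of_linearIndependent_row (basisMatrix_linearIndependent L)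
  have hCY : A * B * (B⁻¹ * Y) = 1 := by
    rw [Matrix.mul_assoc, Matrix.mul_nonsing_inv_cancel_left _ _ hdB, hY]
  have hCD : A * B * Dᵀ = 0 := by
    ext i j
    have hj : D j ∈ orth B L.1 := (Module.finBasisOfFinrankEq F L'.1 L'.2 j).2
    have := mem_orth.1 hj (A i) (Module.finBasisOfFinrankEq F L.1 L.2 i).2
    exact this
  have key := star_minors_mul_det h hCD hCY
  -- Were the common factor zero, all maximal minors of the basis matrix `D` would vanish.
  have hd : (stack h (B⁻¹ * Y)ᵀ D).det ≠ 0 := by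
    intro h0
    refine maxMinors_ne_zero D (basisMatrix_linearIndependent L') (funext fun J => ?_)
    have := key J
    rw [h0, mul_zero] at this
    exact this.symm
  unfold plucker
  rw [Projectivization.map_mk, eq_comm, Projectivization.mk_eq_mk_iff']
  refine ⟨(stack h (B⁻¹ * Y)ᵀ D).det, ?_⟩
  funext J
  change _ * star F h (minors A ᵥ* wedge ℓ B) J = minors D J
  rw [← minors_mul, mul_comm, key]

theorem map_dualityEquiv_fixedVariety (h : ℓ + m = n) {T B : Matrix (Fin n) (Fin n) F}
    (hB : IsUnit B) (hs : B.IsSymm) (hTB : T * B = B * Tᵀ) :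
    Projectivization.map (dualityEquiv h B hB).toLinearMap (dualityEquiv h B hB).injective ''
      fixedVariety ℓ T = fixedVariety m T := by
  ext x
  constructor
  · rintro ⟨_, ⟨L, hL, rfl⟩, rfl⟩
    exact ⟨_, orth_mem_fixedGr h hB hTB hL, (map_dualityEquiv_plucker h hB L).symm⟩
  · rintro ⟨L', hL', rfl⟩
    have h' := (add_comm m ℓ).trans h
    refine ⟨_, ⟨⟨orth B L'.1, orth_mem_Gr h' hB L'.2⟩, orth_mem_fixedGr h' hB hTB hL', rfl⟩, ?_⟩
    rw [map_dualityEquiv_plucker]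
    congr 1
    exact Subtype.ext (orth_orth hB hs L'.1)

end Duality

/-! ### Shuffle equations as invariance under the pencil -/

section Shuffle

open Polynomial

variable {F : Type*} [Field F] {n ℓ m : ℕ}

/-- The matrix `Id + z T` of polynomials. -/
noncomputable abbrev pencil (T : Matrix (Fin n) (Fin n) F) : Matrix (Fin n) (Fin n) F[X] :=
  1 + (X : F[X]) • T.map C

/-- This is the reversed characteristic polynomial of $-T$. Nilpotency makes it a unit, hence
constant, and its value at $0$ is $1$. -/
theorem det_pencil {T : Matrix (Fin n) (Fin n) F} (hT : IsNilpotent T) : (pencil T).det = 1 := by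
  have h1 : pencil T = 1 - (X : F[X]) • (-T).map C := by
    ext i j
    simp [Matrix.sub_apply, Matrix.add_apply]
  have h2 : (pencil T).det = (-T).charpolyRev := by rw [h1]; rfl
  rw [h2]
  obtain ⟨c, -, hc⟩ := Polynomial.isUnit_iff.1 (Matrix.isUnit_charpolyRev_of_isNilpotent hT.neg)
  have h3 : (-T).charpolyRev.eval 0 = 1 := Matrix.eval_charpolyRev
  rw [← hc, eval_C] at h3
  rw [← hc, h3, map_one]

theorem pencil_submatrix {ι κ : Type*} (T : Matrix (Fin n) (Fin n) F) (r : ι → Fin n)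
    (c : κ → Fin n) : (pencil T).submatrix r c = (X : F[X]) • (T.submatrix r c).map C
      + ((1 : Matrix (Fin n) (Fin n) F).submatrix r c).map C := by
  ext i j : 1
  by_cases h : r i = c j <;> simp [Matrix.one_apply, h, add_comm]

theorem wedgeCoeff_zero (T : Matrix (Fin n) (Fin n) F) : wedgeCoeff ℓ T 0 = 1 := by
  ext I J
  rw [← wedge_one (ℓ := ℓ)]
  change ((pencil T).submatrix I.seq J.seq).det.coeff 0 = _
  rw [pencil_submatrix, Polynomial.coeff_det_X_add_C_zero]
  rfl

theorem wedgeCoeff_eq_zero (T : Matrix (Fin n) (Fin n) F) {i : ℕ} (hi : ℓ < i) :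
    wedgeCoeff ℓ T i = 0 := by
  ext I J
  change ((pencil T).submatrix I.seq J.seq).det.coeff i = _
  rw [pencil_submatrix]
  refine Polynomial.coeff_eq_zero_of_natDegree_lt ?_
  refine (Polynomial.natDegree_det_X_add_C_le _ _).trans_lt ?_
  rwa [Fintype.card_fin]

theorem coeff_vecMul_wedge_pencil (T : Matrix (Fin n) (Fin n) F) (P : Idx n ℓ → F) (i : ℕ)
    (J : Idx n ℓ) :
    (((fun I => C (P I)) ᵥ* wedge ℓ (pencil T)) J).coeff i = (P ᵥ* wedgeCoeff ℓ T i) J := by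
  simp only [Matrix.vecMul, dotProduct, Polynomial.finsetSum_coeff, Polynomial.coeff_C_mul]
  rfl

/-- Comparing coefficients of $z^i$: degree $0$ holds automatically, degrees above $\ell$ vanish on
both sides, and degrees $1,\dots,\ell$ are the shuffle equations. -/
theorem mem_dualCoannihilator_shuffleEquations {T : Matrix (Fin n) (Fin n) F}
    {P : Idx n ℓ → F} :
    P ∈ (Submodule.span F (shuffleEquations ℓ T)).dualCoannihilator ↔
      (fun I => C (P I)) ᵥ* wedge ℓ (pencil T) = fun I => C (P I) := by
  rw [← SetLike.mem_coe, Submodule.coe_dualCoannihilator_span]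
  constructor
  · intro h
    funext J
    ext i
    rw [coeff_vecMul_wedge_pencil]
    rcases Nat.eq_zero_or_pos i with rfl | hi
    · rw [wedgeCoeff_zero, Matrix.vecMul_one, coeff_C_zero]
    · rw [coeff_C_of_ne_zero hi.ne']
      by_cases hiℓ : i ≤ ℓ
      · exact h (LinearMap.proj J ∘ₗ (wedgeCoeff ℓ T i).vecMulLinear)
          ⟨i, Finset.mem_Icc.2 ⟨hi, hiℓ⟩, J, fun _ => rfl⟩
      · rw [wedgeCoeff_eq_zero T (not_le.1 hiℓ), Matrix.vecMul_zero, Pi.zero_apply]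
  · rintro h f ⟨i, hi, J, hf⟩
    rw [hf, ← coeff_vecMul_wedge_pencil, h, coeff_C_of_ne_zero]
    have := (Finset.mem_Icc.1 hi).1
    omega

theorem star_vecMul_wedge_eq_iff {R : Type*} [CommRing R] (h : ℓ + m = n)
    {A B : Matrix (Fin n) (Fin n) R} (hA : A.det = 1) (hB : IsUnit B) (hAB : A * B = B * Aᵀ)
    (P : Idx n ℓ → R) :
    star R h (P ᵥ* wedge ℓ B) ᵥ* wedge m A = star R h (P ᵥ* wedge ℓ B) ↔ P ᵥ* wedge ℓ A = P := by
  have hstar : ∀ Q : Idx n ℓ → R, star R h (Q ᵥ* wedge ℓ Aᵀ) ᵥ* wedge m A = star R h Q := by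
    intro Q
    have := star_vecMul_wedge h Aᵀ Q
    rwa [Matrix.transpose_transpose, Matrix.det_transpose, hA, one_smul] at this
  have hcomm : P ᵥ* wedge ℓ B ᵥ* wedge ℓ Aᵀ = P ᵥ* wedge ℓ A ᵥ* wedge ℓ B := by
    rw [Matrix.vecMul_vecMul, Matrix.vecMul_vecMul, ← wedge_mul, ← wedge_mul, hAB]
  have hcancel : ∀ {E : Matrix (Fin n) (Fin n) R}, IsUnit E → ∀ Q : Idx n ℓ → R,
      Q ᵥ* wedge ℓ E ᵥ* wedge ℓ E⁻¹ = Q := by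
    intro E hE Q
    rw [Matrix.vecMul_vecMul, ← wedge_mul,
      Matrix.mul_nonsing_inv _ ((Matrix.isUnit_iff_isUnit_det E).1 hE), wedge_one,
      Matrix.vecMul_one]
  have hcancel' : ∀ {E : Matrix (Fin n) (Fin n) R}, IsUnit E → ∀ Q : Idx n ℓ → R,
      Q ᵥ* wedge ℓ E⁻¹ ᵥ* wedge ℓ E = Q := by
    intro E hE Q
    rw [Matrix.vecMul_vecMul, ← wedge_mul,
      Matrix.nonsing_inv_mul _ ((Matrix.isUnit_iff_isUnit_det E).1 hE), wedge_one,
      Matrix.vecMul_one]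
  have hAt : IsUnit Aᵀ := by
    rw [Matrix.isUnit_iff_isUnit_det, Matrix.det_transpose, hA]
    exact isUnit_one
  constructor
  -- The determinant identity gives $(P\wedge B)^*\wedge A=(P\wedge B\wedge(A^t)^{-1})^*$.
  -- Injectivity of the star and cancellation of $\wedge B$ then give the claim.
  · intro hP
    have h1 := hstar (P ᵥ* wedge ℓ B ᵥ* wedge ℓ Aᵀ⁻¹)
    rw [hcancel' hAt, hP] at h1
    have h2 := star_injective h h1
    have h3 := congrArg (· ᵥ* wedge ℓ Aᵀ) h2
    beta_reduce at h3
    rw [hcancel' hAt, hcomm] at h3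
    have h4 := congrArg (· ᵥ* wedge ℓ B⁻¹) h3
    beta_reduce at h4
    rwa [hcancel hB, hcancel hB] at h4
  · intro hP
    have h1 := hstar (P ᵥ* wedge ℓ B)
    rwa [hcomm, hP] at h1

theorem dualityEquiv_map_C (h : ℓ + m = n) {B : Matrix (Fin n) (Fin n) F} (hB : IsUnit B)
    (P : Idx n ℓ → F) :
    (fun J => C (dualityEquiv h B hB P J))
      = star F[X] h ((fun I => C (P I)) ᵥ* wedge ℓ (B.map C)) := by
  funext J
  rw [dualityEquiv_apply, star_apply, star_apply, wedge_map]
  simp [Matrix.vecMul, dotProduct]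

theorem map_dualMap_span_shuffleEquations (h : ℓ + m = n) {T B : Matrix (Fin n) (Fin n) F}
    (hT : IsNilpotent T) (hB : IsUnit B) (hTB : T * B = B * Tᵀ) :
    (Submodule.span F (shuffleEquations m T)).map (dualityEquiv h B hB).dualMap.toLinearMap
      = Submodule.span F (shuffleEquations ℓ T) := by
  -- In finite dimension a space of linear forms is determined by its common zeros, so only these
  -- are compared.
  rw [← Subspace.dualCoannihilator_dualAnnihilator_eq (W := Submodule.span F (shuffleEquations ℓ T)),
    ← Subspace.dualCoannihilator_dualAnnihilator_eq (W := Submodule.map _ _)]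
  congr 1
  ext P
  have hBC : IsUnit (B.map (C : F →+* F[X])) := hB.map (C : F →+* F[X]).mapMatrix
  have hcomm : pencil T * B.map C = B.map C * (pencil T)ᵀ := by
    have := congrArg (fun A : Matrix (Fin n) (Fin n) F => A.map (C : F →+* F[X])) hTB
    simp only [Matrix.map_mul] at this
    simp only [pencil, Matrix.add_mul, Matrix.one_mul, Matrix.smul_mul, this,
      Matrix.transpose_add, Matrix.transpose_one, Matrix.transpose_smul, Matrix.mul_add,
      Matrix.mul_one, Matrix.mul_smul, Matrix.transpose_map]
  rw [mem_dualCoannihilator_shuffleEquations,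
    ← star_vecMul_wedge_eq_iff h (det_pencil hT) hBC hcomm, ← dualityEquiv_map_C h hB,
    ← mem_dualCoannihilator_shuffleEquations, Submodule.mem_dualCoannihilator,
    Submodule.mem_dualCoannihilator]
  constructor
  · intro hP φ hφ
    exact hP _ (Submodule.mem_map_of_mem hφ)
  · rintro hP _ ⟨φ, hφ, rfl⟩
    exact hP φ hφ

end Shuffle

/-! ### Self-adjointness of the Jordan matrix -/

section BlockForm

variable {K : Type*} [Field K] {n : ℕ}

theorem antidiagonalBlock_transpose (m : ℕ) :
    (antidiagonalBlock K m)ᵀ = antidiagonalBlock K m := by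
  ext i j
  simp [antidiagonalBlock, add_comm]

theorem antidiagonalBlock_mul_apply (m : ℕ) (A : Matrix (Fin m) (Fin m) K) (i j : Fin m) :
    (antidiagonalBlock K m * A) i j = A i.rev j := by
  rw [Matrix.mul_apply, Finset.sum_eq_single i.rev]
  · have : (i : ℕ) + (i.rev : ℕ) + 1 = m := by rw [Fin.val_rev]; omega
    rw [antidiagonalBlock, of_apply, if_pos this, one_mul]
  · intro b _ hb
    have : ¬ ((i : ℕ) + b + 1 = m) := fun h => hb (Fin.ext (by rw [Fin.val_rev]; omega))
    simp [antidiagonalBlock, this]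
  · simp

theorem mul_antidiagonalBlock_apply (m : ℕ) (A : Matrix (Fin m) (Fin m) K) (i j : Fin m) :
    (A * antidiagonalBlock K m) i j = A i j.rev := by
  rw [← Matrix.transpose_apply (A * _), Matrix.transpose_mul, antidiagonalBlock_transpose,
    antidiagonalBlock_mul_apply, Matrix.transpose_apply]

theorem antidiagonalBlock_mul_self (m : ℕ) :
    antidiagonalBlock K m * antidiagonalBlock K m = 1 := by
  ext i j
  rw [antidiagonalBlock_mul_apply, Matrix.one_apply]
  simp only [antidiagonalBlock, of_apply, Fin.val_rev, Fin.ext_iff]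
  congr 1
  simp only [eq_iff_iff]
  omega

/-- Reversing the columns of the Jordan block puts its ones where $i+j+2=m$ (indices from $0$), a
condition symmetric in $i$ and $j$. -/
theorem jordanBlock_mul_antidiagonalBlock (m : ℕ) :
    jordanBlock K m * antidiagonalBlock K m = antidiagonalBlock K m * (jordanBlock K m)ᵀ := by
  ext i j
  rw [antidiagonalBlock_mul_apply, mul_antidiagonalBlock_apply]
  simp only [jordanBlock, of_apply, transpose_apply, Fin.val_rev]
  congr 1
  simp only [eq_iff_iff]
  omega

theorem blockAntidiagonal_transpose (lam : n.Partition) :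
    (blockAntidiagonal K lam)ᵀ = blockAntidiagonal K lam := by
  rw [blockAntidiagonal, Matrix.transpose_reindex, Matrix.blockDiagonal'_transpose]
  simp only [antidiagonalBlock_transpose]

theorem blockAntidiagonal_mul_self (lam : n.Partition) :
    blockAntidiagonal K lam * blockAntidiagonal K lam = 1 := by
  simp only [blockAntidiagonal, Matrix.reindex_apply]
  rw [Matrix.submatrix_mul_equiv, ← Matrix.blockDiagonal'_mul]
  simp only [antidiagonalBlock_mul_self]
  rw [show (fun k => (1 : Matrix (Fin (part lam k)) (Fin (part lam k)) K)) = 1 from rfl,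
    Matrix.blockDiagonal'_one, Matrix.submatrix_one_equiv]

theorem jordanNilpotent_mul_blockAntidiagonal (lam : n.Partition) :
    jordanNilpotent K lam * blockAntidiagonal K lam
      = blockAntidiagonal K lam * (jordanNilpotent K lam)ᵀ := by
  simp only [blockAntidiagonal, jordanNilpotent, Matrix.reindex_apply, Matrix.transpose_submatrix]
  rw [Matrix.submatrix_mul_equiv, Matrix.submatrix_mul_equiv, Matrix.blockDiagonal'_transpose,
    ← Matrix.blockDiagonal'_mul, ← Matrix.blockDiagonal'_mul]
  simp only [jordanBlock_mul_antidiagonalBlock]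

theorem selfAdjoint_of_jordan {T B : Matrix (Fin n) (Fin n) K} {lam : n.Partition}
    {g : GL (Fin n) K} (hT : T = g.1 * jordanNilpotent K lam * g⁻¹.1)
    (hB : B = g.1 * blockAntidiagonal K lam * g.1ᵀ) :
    B.IsSymm ∧ IsUnit B ∧ T * B = B * Tᵀ := by
  have hg : g⁻¹.1 * g.1 = 1 := g.inv_mul
  refine ⟨?_, ?_, ?_⟩
  · rw [Matrix.IsSymm, hB]
    simp only [Matrix.transpose_mul, Matrix.transpose_transpose, blockAntidiagonal_transpose,
      Matrix.mul_assoc]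
  · rw [hB]
    have h1 : IsUnit (blockAntidiagonal K lam) :=
      IsUnit.of_mul_eq_one _ (blockAntidiagonal_mul_self lam)
    exact (g.isUnit.mul h1).mul ((Matrix.isUnit_transpose g.1).2 g.isUnit)
  · have hgt : g.1ᵀ * (g⁻¹.1)ᵀ = 1 := by rw [← Matrix.transpose_mul, hg, Matrix.transpose_one]
    calc T * B = g.1 * jordanNilpotent K lam * (g⁻¹.1 * g.1) * blockAntidiagonal K lam * g.1ᵀ := by
          rw [hT, hB]; simp only [Matrix.mul_assoc]
      _ = g.1 * (jordanNilpotent K lam * blockAntidiagonal K lam) * g.1ᵀ := by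
          rw [hg]; simp only [Matrix.mul_assoc, Matrix.mul_one]
      _ = g.1 * blockAntidiagonal K lam * (g.1ᵀ * (g⁻¹.1)ᵀ) * (jordanNilpotent K lam)ᵀ * g.1ᵀ := by
          rw [jordanNilpotent_mul_blockAntidiagonal, hgt]
          simp only [Matrix.mul_assoc, Matrix.one_mul]
      _ = B * Tᵀ := by
          rw [hT, hB]; simp only [Matrix.mul_assoc, Matrix.transpose_mul]

end BlockForm

/-! ### Existence of the Jordan form -/

section JordanForm

open Polynomial Module

variable {K : Type*} [Field K]

/-- The `K`-basis `1, X, …, X ^ (k - 1)` of `K[X] / (X ^ k)`. -/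
theorem exists_basis_quotient_X_pow (k : ℕ) :
    ∃ b : Basis (Fin k) K (K[X] ⧸ Submodule.span K[X] {(X : K[X]) ^ k}),
      ∀ j, b j = Submodule.Quotient.mk (X ^ (j : ℕ)) := by
  have hm : (X ^ k : K[X]).Monic := monic_X_pow k
  let b : Basis (Fin k) K (AdjoinRoot (X ^ k : K[X])) := (AdjoinRoot.powerBasis' hm).basis.reindex
    (finCongr (show (AdjoinRoot.powerBasis' hm).dim = k from natDegree_X_pow k))
  have hb : ∀ j, b j = AdjoinRoot.mk (X ^ k : K[X]) (X ^ (j : ℕ)) := fun j => by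
    rw [Basis.reindex_apply, PowerBasis.basis_eq_pow, AdjoinRoot.powerBasis'_gen, map_pow]
    rfl
  exact ⟨b, hb⟩

theorem dfinsupp_basis_apply {ι : Type*} [DecidableEq ι] {η : ι → Type*} {M : ι → Type*}
    [∀ i, AddCommGroup (M i)] [∀ i, Module K (M i)] (b : ∀ i, Basis (η i) K (M i)) (i : ι)
    (j : η i) : DFinsupp.basis b ⟨i, j⟩ = DFinsupp.single i (b i j) := by
  rw [Basis.apply_eq_iff]
  ext ⟨i', j'⟩
  classical
  by_cases h : i' = i
  · subst h
    simp [DFinsupp.basis, Finsupp.single_apply]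
  · simp [DFinsupp.basis, h, Ne.symm h]

/-- Let $X$ act on $V$ as $f$. Nilpotency makes $V$ an $X$-power torsion module, hence a sum of
modules $K[X]/(X^{k_i})$, on whose bases of powers of $X$ the action is a shift. -/
theorem exists_jordan_basis {V : Type*} [AddCommGroup V] [Module K V] [Module.Finite K V]
    {f : Module.End K V} (hf : IsNilpotent f) :
    ∃ (d : ℕ) (k : Fin d → ℕ) (b : Basis (Σ i, Fin (k i)) K V),
      ∀ i (j : Fin (k i)),
        f (b ⟨i, j⟩) = if h : (j : ℕ) + 1 < k i then b ⟨i, ⟨j + 1, h⟩⟩ else 0 := by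
  obtain ⟨N, hN⟩ := hf
  have htors : Module.IsTorsion' (AEval' f) (Submonoid.powers (X : K[X])) := by
    intro x
    obtain ⟨v, rfl⟩ := (AEval'.of f).surjective x
    refine ⟨⟨X ^ N, N, rfl⟩, ?_⟩
    change (X ^ N : K[X]) • AEval'.of f v = 0
    rw [AEval'.X_pow_smul_of, hN]
    simp
  obtain ⟨d, k, ⟨e⟩⟩ := Module.torsion_by_prime_power_decomposition
    (irreducible_X : Irreducible (X : K[X])) htors
  choose b hb using fun i => exists_basis_quotient_X_pow (K := K) (k i)
  let c : Basis (Σ i, Fin (k i)) K V :=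
    (DFinsupp.basis b).map ((e.restrictScalars K).symm.trans (AEval'.of f).symm)
  have hc : ∀ i j, c ⟨i, j⟩ = (AEval'.of f).symm (e.symm
      (DirectSum.lof K[X] (Fin d) (fun i => K[X] ⧸ Submodule.span K[X] {(X : K[X]) ^ k i}) i
        (Submodule.Quotient.mk (X ^ (j : ℕ))))) := by
    intro i j
    rw [Basis.map_apply, dfinsupp_basis_apply, hb]
    rfl
  refine ⟨d, k, c, fun i j => ?_⟩
  have h1 : f (c ⟨i, j⟩) = (AEval'.of f).symm (e.symm
      (DirectSum.lof K[X] (Fin d) (fun i => K[X] ⧸ Submodule.span K[X] {(X : K[X]) ^ k i}) i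
        (Submodule.Quotient.mk (X ^ ((j : ℕ) + 1))))) := by
    apply (AEval'.of f).injective
    rw [LinearEquiv.apply_symm_apply, ← AEval'.X_smul_of, hc, LinearEquiv.apply_symm_apply,
      ← map_smul, ← map_smul, ← Submodule.Quotient.mk_smul, smul_eq_mul, pow_succ']
  rw [h1]
  split_ifs with h
  · rw [hc]
  · have hk : (j : ℕ) + 1 = k i := le_antisymm j.2 (not_lt.1 h)
    rw [hk, (Submodule.Quotient.mk_eq_zero _).2 (Submodule.mem_span_singleton_self _)]
    simp

/-- Equal multisets of values mean fibres of equal size, which can be matched one by one. -/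
theorem exists_equiv_of_map_eq {α β : Type*} [Fintype α] [Fintype β] {f : α → ℕ} {g : β → ℕ}
    (h : Finset.univ.val.map f = Finset.univ.val.map g) : ∃ e : α ≃ β, ∀ a, g (e a) = f a := by
  have hfib : ∀ c, Nonempty ({a // f a = c} ≃ {b // g b = c}) := by
    intro c
    refine ⟨Fintype.equivOfCardEq ?_⟩
    have h1 := congrArg (Multiset.count c) h
    rw [Multiset.count_map, Multiset.count_map] at h1
    rw [Fintype.card_subtype, Fintype.card_subtype]
    simpa [Finset.card_def, eq_comm] using h1
  exact ⟨Equiv.ofFiberEquiv fun c => (hfib c).some, fun a => Equiv.ofFiberEquiv_map _ a⟩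

/-- The decomposition may contain zero summands, with $k_i=0$; they carry no basis vectors and are
dropped, as `Nat.Partition.ofSums` drops zero parts. -/
theorem exists_partition_equiv {n d : ℕ} (k : Fin d → ℕ) (hk : ∑ i, k i = n) :
    ∃ (lam : n.Partition) (e : Fin (sortedParts lam).length ≃ {i // k i ≠ 0}),
      ∀ x, k (e x) = part lam x := by
  refine ⟨Nat.Partition.ofSums n (Finset.univ.val.map k) hk, ?_⟩
  set lam := Nat.Partition.ofSums n (Finset.univ.val.map k) hk
  refine exists_equiv_of_map_eq (g := fun i : {i // k i ≠ 0} => k i) ?_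
  have h1 : (Finset.univ.val.map (part lam)) = lam.parts := by
    rw [← Multiset.sort_eq lam.parts (fun a b => b ≤ a)]
    change _ = ((sortedParts lam : List ℕ) : Multiset ℕ)
    conv_rhs => rw [← List.ofFn_get (sortedParts lam)]
    rw [Fin.univ_val_map]
    rfl
  rw [h1]
  change (Finset.univ.val.map k).filter (· ≠ 0) = _
  rw [Multiset.filter_map]
  exact (Finset.univ_val_map_subtype_restrict k (fun i => k i ≠ 0)).symm

theorem exists_jordanNilpotent {n : ℕ} {T : Matrix (Fin n) (Fin n) K} (hT : IsNilpotent T) :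
    ∃ (lam : n.Partition) (g : GL (Fin n) K), T = g.1 * jordanNilpotent K lam * g⁻¹.1 := by
  have hf : IsNilpotent (T.vecMulLinear : Module.End K (Fin n → K)) := by
    obtain ⟨N, hN⟩ := hT
    refine ⟨N, ?_⟩
    have : ∀ i, (T.vecMulLinear : Module.End K (Fin n → K)) ^ i = (T ^ i).vecMulLinear := by
      intro i
      induction i with
      | zero => ext; simp
      | succ i ih =>
        rw [pow_succ', ih, pow_succ]
        refine LinearMap.ext fun v => ?_
        simp [Matrix.vecMul_vecMul]
    rw [this, hN]
    ext
    simp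
  obtain ⟨d, k, b, hb⟩ := exists_jordan_basis hf
  have hk : ∑ i, k i = n := by
    have := Module.finrank_eq_card_basis b
    simpa using this.symm
  obtain ⟨lam, e, he⟩ := exists_partition_equiv k hk
  let φ : (Σ x, Fin (part lam x)) → (Σ i, Fin (k i)) := fun p => ⟨e p.1, Fin.cast (he p.1).symm p.2⟩
  have hφ : Function.Bijective φ := by
    constructor
    · rintro ⟨x, j⟩ ⟨y, j'⟩ h
      simp only [φ, Sigma.mk.injEq] at h
      obtain ⟨h1, h2⟩ := h
      obtain rfl : x = y := e.injective (Subtype.ext h1)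
      simp only [heq_eq_eq, Fin.cast_inj] at h2
      rw [h2]
    · rintro ⟨i, j⟩
      have hi : k i ≠ 0 := by have := j.2; omega
      refine ⟨⟨e.symm ⟨i, hi⟩, Fin.cast (by rw [← he, Equiv.apply_symm_apply]) j⟩, ?_⟩
      apply Sigma.ext
      · simp [φ]
      · simp only [φ]
        rw [Fin.heq_ext_iff]
        · rfl
        · simp
  let c : Basis (Fin n) K (Fin n → K) :=
    b.reindex ((Equiv.ofBijective φ hφ).symm.trans (blockIndex lam))
  have hc : ∀ p, c (blockIndex lam p) = b (φ p) := by
    intro p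
    simp [c, Basis.reindex_apply]
  -- Since matrices act on row vectors, the Jordan basis forms the rows of `G`. Then `G * T =
  -- jordanNilpotent K lam * G`, and the required `g` is the inverse of `G`.
  let G : Matrix (Fin n) (Fin n) K := Matrix.of fun i => c i
  have hG : IsUnit G := Matrix.linearIndependent_rows_iff_isUnit.1 c.linearIndependent
  have hGT : G * T = jordanNilpotent K lam * G := by
    funext r
    obtain ⟨⟨x, j⟩, rfl⟩ := (blockIndex lam).surjective r
    have h1 : (G * T) (blockIndex lam ⟨x, j⟩) = T.vecMulLinear (b (φ ⟨x, j⟩)) := by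
      rw [← hc]; rfl
    have h2 : (jordanNilpotent K lam * G) (blockIndex lam ⟨x, j⟩)
        = ∑ j' : Fin (part lam x), jordanBlock K (part lam x) j j' • b (φ ⟨x, j'⟩) := by
      have h3 : (jordanNilpotent K lam * G) (blockIndex lam ⟨x, j⟩)
          = ∑ s, jordanNilpotent K lam (blockIndex lam ⟨x, j⟩) s • c s := by
        ext t
        simp [Matrix.mul_apply, G]
      rw [h3, ← (blockIndex lam).sum_comp, Fintype.sum_sigma, Finset.sum_eq_single x]
      · refine Finset.sum_congr rfl fun j' _ => ?_
        simp [jordanNilpotent, hc]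
      · intro y _ hy
        refine Finset.sum_eq_zero fun j' _ => ?_
        simp [jordanNilpotent, Matrix.blockDiagonal'_apply_ne _ _ _ hy.symm]
      · simp
    rw [h1, h2, hb]
    have hx : k (e x) = part lam x := he x
    split_ifs with h
    · have h' : (j : ℕ) + 1 < part lam x := lt_of_lt_of_eq h hx
      rw [Finset.sum_eq_single ⟨j + 1, h'⟩]
      · simp [jordanBlock, φ]
      · intro j' _ hj'
        have : ¬ ((j : ℕ) + 1 = j') := fun hjj => hj' (Fin.ext hjj.symm)
        simp [jordanBlock, this]
      · simp
    · refine (Finset.sum_eq_zero fun j' _ => ?_).symm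
      have : ¬ ((j : ℕ) + 1 = j') := fun hjj => h (by
        change (j : ℕ) + 1 < k (e x)
        rw [hx, hjj]
        exact j'.2)
      simp [jordanBlock, this]
  refine ⟨lam, hG.unit⁻¹, ?_⟩
  rw [inv_inv, Matrix.mul_assoc]
  change T = hG.unit⁻¹.1 * (jordanNilpotent K lam * G)
  rw [← hGT, ← Matrix.mul_assoc]
  have : hG.unit⁻¹.1 * G = 1 := hG.val_inv_mul
  rw [this, Matrix.one_mul]

end JordanForm

end NilpotentGrassmannian

theorem mainTheorem3 {K : Type*} [Field K] {n ℓ : ℕ} (hℓ : ℓ ≤ n)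
    (T : Matrix (Fin n) (Fin n) K) (hT : IsNilpotent T) :
    -- `T` has a Jordan canonical form
    (∃ (lam : n.Partition) (g : GL (Fin n) K),
      T = g.1 * jordanNilpotent K lam * g⁻¹.1) ∧
    -- and every Jordan canonical form of `T` gives a symmetric form `B` and a duality
    ∀ (lam : n.Partition) (g : GL (Fin n) K),
      T = g.1 * jordanNilpotent K lam * g⁻¹.1 →
      ∀ B : Matrix (Fin n) (Fin n) K,
        B = g.1 * blockAntidiagonal K lam * g.1ᵀ →
        -- `T` is self-adjoint for the non-degenerate symmetric form `B`
        B.IsSymm ∧ IsUnit B ∧ T * B = B * Tᵀ ∧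
        -- the linear change of coordinates, over `K` and over all its extension fields
        ∀ (F : Type*) [Field F] [Algebra K F] (T' B' : Matrix (Fin n) (Fin n) F),
          T' = T.map (algebraMap K F) → B' = B.map (algebraMap K F) →
          ∃ Φ : (Idx n ℓ → F) ≃ₗ[F]
              (Idx n (n - ℓ) → F),
            (∀ P, Φ P = hodgeStar (Nat.add_sub_of_le hℓ)
              (P ᵥ* wedge ℓ B')) ∧
            -- it identifies the two fixed point loci
            Projectivization.map Φ.toLinearMap Φ.injective ''
                fixedVariety ℓ T' =
              fixedVariety (n - ℓ) T' ∧
            -- on subspaces it is `L ↦ L^⊥`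
            (∃ h : Set.BijOn (orth B')
                (Gr F n ℓ) (Gr F n (n - ℓ)),
              ∀ L : Gr F n ℓ,
                Projectivization.map Φ.toLinearMap Φ.injective
                    (plucker L) =
                  plucker
                    ⟨orth B' L.1, h.mapsTo L.2⟩) ∧
            Set.BijOn (orth B')
              (fixedGr ℓ T')
              (fixedGr (n - ℓ) T') ∧
            -- substituting it carries the span of the shuffle equations onto the other one
            (Submodule.span F (shuffleEquations (n - ℓ) T')).map
                Φ.dualMap.toLinearMap =
              Submodule.span F (shuffleEquations ℓ T') := by
  refine ⟨exists_jordanNilpotent hT, fun lam g hg B hB => ?_⟩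
  obtain ⟨hs, hu, hTB⟩ := selfAdjoint_of_jordan hg hB
  refine ⟨hs, hu, hTB, ?_⟩
  rintro F _ _ T' B' rfl rfl
  -- Only the hypotheses are transported to `F`; the duality is then applied over `F` itself.
  have hs' : (B.map (algebraMap K F)).IsSymm := hs.map _
  have hu' : IsUnit (B.map (algebraMap K F)) := hu.map (algebraMap K F).mapMatrix
  have hT' : IsNilpotent (T.map (algebraMap K F)) := hT.map (algebraMap K F).mapMatrix
  have hTB' : T.map (algebraMap K F) * B.map (algebraMap K F)
      = B.map (algebraMap K F) * (T.map (algebraMap K F))ᵀ := by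
    rw [← Matrix.transpose_map, ← Matrix.map_mul, ← Matrix.map_mul, hTB]
  have h := Nat.add_sub_of_le hℓ
  exact ⟨dualityEquiv h _ hu', fun _ => rfl, map_dualityEquiv_fixedVariety h hu' hs' hTB',
    ⟨bijOn_orth_Gr h hu' hs', fun L => map_dualityEquiv_plucker h hu' L⟩,
    bijOn_orth_fixedGr h hu' hs' hTB', map_dualMap_span_shuffleEquations h hT' hu' hTB'⟩
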